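/- For $d\ge 1$ let $\mathbb B_d$ be the open unit ball of $\mathbb C^d$ in the Euclidean norm, and let $H^2_d$ (the Drury--Arveson space) be the Hilbert space of holomorphic functions on $\mathbb B_d$ with reproducing kernel $$k(z,w)=\frac{1}{1-\langle z,w\rangle},\qquad \langle z,w\rangle=\sum_{i=1}^d z_i\overline{w_i}.$$ A multiplier of $H^2_d$ is a function $m:\mathbb B_d\to\mathbb C$ such that $mf\in H^2_d$ for every $f\in H^2_d$; write $\mathrm{Mult}(H^2_d)$ for the set of multipliers. The Nevanlinna class of $H^2_d$ is $$N(H^2_d)=\{\, g/m : g\in H^2_d,\ m\in \mathrm{Mult}(H^2_d),\ m(z)\neq 0 \text{ for all } z\in\mathbb B_d \,\}.$$ Theorem. For every integer $d\ge 2$ there is a continuous function $f:\overline{\mathbb B_d}\to\mathbb C$, holomorphic on $\mathbb B_d$, whose restriction to $\mathbb B_d$ does not belong to $N(H^2_d)$. -/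

import Mathlib

/-- The open unit ball of `ℂ^d` (with the Euclidean norm), as a type. -/
abbrev UnitBall (d : ℕ) : Type :=
  ↥(Metric.ball (0 : EuclideanSpace ℂ (Fin d)) 1)

/-- The kernel `k(z, w) = 1 / (1 - ⟨z, w⟩)` on the unit ball, where `⟨z, w⟩ = ∑ i, z i * conj (w i)`
(Mathlib's `inner ℂ` is conjugate-linear in its first argument). A complex number `c` is regarded as
the operator of multiplication by `c` on `ℂ`, which is the form in which Mathlib treats kernels. -/
noncomputable def druryArvesonKernel (d : ℕ) : Matrix (UnitBall d) (UnitBall d) (ℂ →L[ℂ] ℂ) :=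
  Matrix.of fun z w =>
    (1 / (1 - inner ℂ (w : EuclideanSpace ℂ (Fin d)) (z : EuclideanSpace ℂ (Fin d)))) •
      ContinuousLinearMap.id ℂ ℂ

theorem druryArvesonKernel_apply {d : ℕ} (z w : UnitBall d) (c : ℂ) :
    druryArvesonKernel d z w c =
      1 / (1 - inner ℂ (w : EuclideanSpace ℂ (Fin d)) (z : EuclideanSpace ℂ (Fin d))) * c := by
  simp [druryArvesonKernel]

theorem UnitBall.norm_inner_lt_one {d : ℕ} (z w : UnitBall d) :
    ‖inner ℂ (w : EuclideanSpace ℂ (Fin d)) (z : EuclideanSpace ℂ (Fin d))‖ < 1 := by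
  have hz : ‖(z : EuclideanSpace ℂ (Fin d))‖ < 1 := mem_ball_zero_iff.mp z.2
  have hw : ‖(w : EuclideanSpace ℂ (Fin d))‖ < 1 := mem_ball_zero_iff.mp w.2
  refine lt_of_le_of_lt (norm_inner_le_norm _ _) ?_
  nlinarith [norm_nonneg (z : EuclideanSpace ℂ (Fin d)),
    norm_nonneg (w : EuclideanSpace ℂ (Fin d))]

/-- The powers of the inner product are positive semidefinite kernels. -/
theorem inner_pow_sum_nonneg {d : ℕ} (n : ℕ) (s : Finset (UnitBall d)) (v : UnitBall d → ℂ) :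
    0 ≤ (∑ x ∈ s, ∑ y ∈ s, (starRingEnd ℂ) (v x) * v y *
      inner ℂ (y : EuclideanSpace ℂ (Fin d)) (x : EuclideanSpace ℂ (Fin d)) ^ n).re := by
  have key : (∑ x ∈ s, ∑ y ∈ s, (starRingEnd ℂ) (v x) * v y *
      inner ℂ (y : EuclideanSpace ℂ (Fin d)) (x : EuclideanSpace ℂ (Fin d)) ^ n) =
      ∑ p : Fin n → Fin d, (starRingEnd ℂ)
        (∑ x ∈ s, v x * (starRingEnd ℂ) (∏ j, (x : EuclideanSpace ℂ (Fin d)) (p j))) *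
        (∑ y ∈ s, v y * (starRingEnd ℂ) (∏ j, (y : EuclideanSpace ℂ (Fin d)) (p j))) := by
    simp only [map_sum, Finset.sum_mul_sum]
    rw [Finset.sum_comm]
    conv_rhs => rw [Finset.sum_comm]
    rw [Finset.sum_comm]
    refine Finset.sum_congr rfl fun x _ => ?_
    rw [Finset.sum_comm]
    refine Finset.sum_congr rfl fun y _ => ?_
    rw [PiLp.inner_apply, Fintype.sum_pow, Finset.mul_sum]
    refine Finset.sum_congr rfl fun p _ => ?_
    simp only [RCLike.inner_apply, Finset.prod_mul_distrib, map_mul, map_prod, Complex.conj_conj]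
    ring
  rw [key, Complex.re_sum]
  refine Finset.sum_nonneg fun p _ => ?_
  rw [mul_comm, Complex.mul_conj, Complex.ofReal_re]
  exact Complex.normSq_nonneg _

theorem druryArvesonKernel_isHermitian (d : ℕ) : (druryArvesonKernel d).IsHermitian := by
  ext z w
  refine ext_inner_right ℂ fun c => ?_
  rw [Matrix.conjTranspose_apply, ContinuousLinearMap.star_eq_adjoint,
    ContinuousLinearMap.adjoint_inner_left, druryArvesonKernel_apply, druryArvesonKernel_apply]
  simp only [RCLike.inner_apply, map_mul, map_div₀, map_sub, map_one, inner_conj_symm]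
  ring

theorem druryArvesonKernel_posSemidef (d : ℕ) : (druryArvesonKernel d).PosSemidef := by
  have htfae := (RKHS.posSemidef_tfae (K := druryArvesonKernel d)).out 0 2
  refine htfae.mpr ⟨druryArvesonKernel_isHermitian d, fun v => ?_⟩
  have hlim : HasSum (fun n : ℕ => (∑ x ∈ v.support, ∑ y ∈ v.support,
      (starRingEnd ℂ) (v x) * v y *
        inner ℂ (y : EuclideanSpace ℂ (Fin d)) (x : EuclideanSpace ℂ (Fin d)) ^ n).re)
      (∑ x ∈ v.support, ∑ y ∈ v.support, (starRingEnd ℂ) (v x) * v y *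
        (1 - inner ℂ (y : EuclideanSpace ℂ (Fin d)) (x : EuclideanSpace ℂ (Fin d)))⁻¹).re :=
    Complex.hasSum_re (hasSum_sum fun x _ => hasSum_sum fun y _ =>
      (hasSum_geometric_of_norm_lt_one (UnitBall.norm_inner_lt_one x y)).mul_left _)
  have h := hlim.nonneg fun n => inner_pow_sum_nonneg n v.support v
  refine h.trans (le_of_eq ?_)
  rw [RCLike.re_eq_complex_re, Finsupp.sum]
  congr 1
  refine Finset.sum_congr rfl fun x _ => Finset.sum_congr rfl fun y _ => ?_
  beta_reduce
  rw [druryArvesonKernel_apply]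
  simp only [RCLike.inner_apply, map_mul, map_div₀, map_sub, map_one, inner_conj_symm]
  ring

instance druryArvesonKernel_fact (d : ℕ) : Fact (druryArvesonKernel d).PosSemidef :=
  ⟨druryArvesonKernel_posSemidef d⟩

/-- The Drury-Arveson space `H²_d`: the Hilbert space of functions on the unit ball of `ℂ^d`
with reproducing kernel `1 / (1 - ⟨z, w⟩)`. An element `f` is evaluated at a point `z` of the ball
by `f z`. -/
noncomputable abbrev DruryArveson (d : ℕ) : Type :=
  RKHS.OfKernel (druryArvesonKernel d)

/-- The multipliers of `H²_d`: the functions `m` on the ball such that `m * f` belongs to `H²_d`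
for every `f` in `H²_d`. -/
def druryArvesonMultipliers (d : ℕ) : Set (UnitBall d → ℂ) :=
  {m | ∀ f : DruryArveson d, ∃ h : DruryArveson d, ∀ z, h z = m z * f z}

/-- The Nevanlinna class `N(H²_d)`: the quotients `g / m` of a function `g` in `H²_d` by a multiplier
`m` of `H²_d` without zeros in the ball. -/
def nevanlinnaClass (d : ℕ) : Set (UnitBall d → ℂ) :=
  {f | ∃ g : DruryArveson d, ∃ m ∈ druryArvesonMultipliers d,
    (∀ z, m z ≠ 0) ∧ ∀ z, f z = g z / m z}

/-- The ball algebra `A(𝔹_d)`: the functions that are continuous on the closed unit ball of `ℂ^d` and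
holomorphic on the open ball. Values outside of the closed ball are irrelevant. -/
def ballAlgebra (d : ℕ) : Set (EuclideanSpace ℂ (Fin d) → ℂ) :=
  {f | ContinuousOn f (Metric.closedBall 0 1) ∧ DifferentiableOn ℂ f (Metric.ball 0 1)}

/-! With `L(w) = ∑ w ^ 256 ^ k / 2 ^ (k + 1)`, the function `L(2 z₀ z₁)` works. Averaging over a
torus of radius 1/2 reads off the coefficient of `(2 z₀ z₁) ^ n`. On the Drury-Arveson space this
functional has norm at most `(2n + 1) ^ (-1/4)` (`norm_diagCoeff_le`), although `2 z₀ z₁` maps the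
closed ball into the closed disc.

If `L(2 z₀ z₁) = g / μ`, then `m = μ · 1` lies in the space and `g = L(2 z₀ z₁) m`. Compare
coefficients at `N = 256 ^ K`: those of `g` and of `m` near `N` are `O(4 ^ (-K))`, while `m(0)`
enters with weight `2 ^ (-K-1)`. Letting `K → ∞` gives `m(0) = 0` (`norm_apply_zero_le_of_eq_mul`),
which contradicts `μ(0) ≠ 0`. -/

open MeasureTheory AddCircle

/-! ### Fourier analysis on the two-dimensional torus -/

/-- The Haar probability measure on the two-dimensional torus. -/
noncomputable abbrev torusMeasure : Measure (UnitAddCircle × UnitAddCircle) :=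
  haarAddCircle.prod haarAddCircle

/-- The `n`-th power of the product of the two coordinates, as a character of the torus. -/
noncomputable def torusChar (n : ℤ) (t : UnitAddCircle × UnitAddCircle) : ℂ :=
  fourier n t.1 * fourier n t.2

/-- The Fourier coefficient of a function on the torus at the diagonal frequency `(n, n)`. -/
noncomputable def diagCoeff (n : ℤ) (φ : UnitAddCircle × UnitAddCircle → ℂ) : ℂ :=
  ∫ t, torusChar (-n) t * φ t ∂torusMeasure

theorem continuous_torusChar (n : ℤ) : Continuous (torusChar n) := by
  unfold torusChar; fun_prop

theorem norm_fourier_apply (n : ℤ) (t : UnitAddCircle) : ‖(fourier n t : ℂ)‖ = 1 :=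
  Circle.norm_coe _

theorem norm_torusChar (n : ℤ) (t) : ‖torusChar n t‖ = 1 := by
  rw [torusChar, norm_mul, norm_fourier_apply, norm_fourier_apply, one_mul]

theorem torusChar_add (m n : ℤ) (t) : torusChar (m + n) t = torusChar m t * torusChar n t := by
  simp only [torusChar, fourier_add]; ring

theorem torusChar_zero (t) : torusChar 0 t = 1 := by simp [torusChar]

theorem conj_torusChar (n : ℤ) (t) : (starRingEnd ℂ) (torusChar n t) = torusChar (-n) t := by
  simp [torusChar]

theorem torusChar_one_pow (n : ℕ) (t) : torusChar 1 t ^ n = torusChar n t := by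
  induction n with
  | zero => simp [torusChar_zero]
  | succ k ih => rw [pow_succ, ih, Nat.cast_succ, torusChar_add]

theorem Continuous.integrable_torus {E : Type*} [NormedAddCommGroup E]
    {φ : UnitAddCircle × UnitAddCircle → E} (h : Continuous φ) : Integrable φ torusMeasure :=
  h.integrable_of_hasCompactSupport (HasCompactSupport.of_compactSpace φ)

theorem integral_fourier_haarAddCircle (n : ℤ) :
    ∫ t : UnitAddCircle, fourier n t ∂haarAddCircle = if n = 0 then 1 else 0 := by
  split_ifs with hn
  · simp [hn]
  · exact integral_eq_zero_of_add_right_eq_neg (fourier_add_half_inv_index hn one_pos)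

theorem integral_torus_fourier_mul_fourier (m n : ℤ) :
    ∫ t, fourier m t.1 * fourier n t.2 ∂torusMeasure = if m = 0 ∧ n = 0 then 1 else 0 := by
  rw [integral_prod_mul (fun s : UnitAddCircle => (fourier m s : ℂ)) (fun s => fourier n s),
    integral_fourier_haarAddCircle, integral_fourier_haarAddCircle]
  by_cases hm : m = 0 <;> by_cases hn : n = 0 <;> simp [hm, hn]

theorem fourier_one_pow (n : ℕ) (t : UnitAddCircle) : (fourier 1 t : ℂ) ^ n = fourier n t := by
  induction n with
  | zero => simp
  | succ k ih => rw [pow_succ, ih, Nat.cast_succ, fourier_add]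

/-- Binomial expansion and orthogonality of characters. -/
theorem diagCoeff_add_pow_eq_sum (n : ℤ) (j : ℕ) (u v : ℂ) :
    diagCoeff n (fun t => (fourier 1 t.1 * u + fourier 1 t.2 * v) ^ j) =
      ∑ i ∈ Finset.range (j + 1), (u ^ i * v ^ (j - i) * (j.choose i : ℂ)) *
        (if (i : ℤ) = n ∧ ((j - i : ℕ) : ℤ) = n then 1 else 0) := by
  have : ∀ t : UnitAddCircle × UnitAddCircle,
      torusChar (-n) t * (fourier 1 t.1 * u + fourier 1 t.2 * v) ^ j =
      ∑ i ∈ Finset.range (j + 1), (u ^ i * v ^ (j - i) * (j.choose i : ℂ)) *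
        (fourier ((i : ℤ) + -n) t.1 * fourier (((j - i : ℕ) : ℤ) + -n) t.2) := by
    intro t
    rw [add_pow, Finset.mul_sum]
    refine Finset.sum_congr rfl fun i _ => ?_
    rw [fourier_add, fourier_add, mul_pow, mul_pow, fourier_one_pow, fourier_one_pow, torusChar]
    ring
  simp only [diagCoeff, this]
  rw [integral_finsetSum _ fun i _ => Continuous.integrable_torus (by fun_prop)]
  refine Finset.sum_congr rfl fun i _ => ?_
  rw [integral_const_mul, integral_torus_fourier_mul_fourier]
  simp only [← sub_eq_add_neg, sub_eq_zero]

theorem diagCoeff_add_pow_of_ne {n : ℤ} {j : ℕ} (h : (j : ℤ) ≠ 2 * n) (u v : ℂ) :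
    diagCoeff n (fun t => (fourier 1 t.1 * u + fourier 1 t.2 * v) ^ j) = 0 := by
  rw [diagCoeff_add_pow_eq_sum]
  refine Finset.sum_eq_zero fun i hi => ?_
  rw [Finset.mem_range] at hi
  rw [if_neg (by lia), mul_zero]

theorem diagCoeff_add_pow (n : ℕ) (u v : ℂ) :
    diagCoeff n (fun t => (fourier 1 t.1 * u + fourier 1 t.2 * v) ^ (2 * n)) =
      n.centralBinom * (u * v) ^ n := by
  rw [diagCoeff_add_pow_eq_sum, Finset.sum_eq_single n]
  · rw [if_pos ⟨rfl, by lia⟩, show 2 * n - n = n by lia, Nat.centralBinom, mul_pow]; ring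
  · intro i _ hi
    rw [if_neg (by lia), mul_zero]
  · intro h
    simp at h
    lia

theorem diagCoeff_torusChar_mul (n j : ℤ) (φ : UnitAddCircle × UnitAddCircle → ℂ) :
    diagCoeff n (fun t => torusChar j t * φ t) = diagCoeff (n - j) φ := by
  simp only [diagCoeff, ← mul_assoc, ← torusChar_add]
  congr! 4
  ring

theorem hasSum_diagCoeff (n : ℤ) {φ : ℕ → UnitAddCircle × UnitAddCircle → ℂ}
    {ψ : UnitAddCircle × UnitAddCircle → ℂ} (hφ : ∀ j, Continuous (φ j)) {b : ℕ → ℝ}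
    (hb : Summable b) (hφb : ∀ j t, ‖φ j t‖ ≤ b j) (h : ∀ t, HasSum (fun j => φ j t) (ψ t)) :
    HasSum (fun j => diagCoeff n (φ j)) (diagCoeff n ψ) := by
  refine hasSum_integral_of_dominated_convergence (fun j _ => b j)
    (fun j => ((continuous_torusChar _).mul (hφ j)).aestronglyMeasurable)
    (fun j => .of_forall fun t => ?_) (.of_forall fun _ => hb) (integrable_const _)
    (.of_forall fun t => (h t).mul_left _)
  rw [norm_mul, norm_torusChar, one_mul]
  exact hφb j t

/-! ### Points of the ball over the torus -/

/-- The point `(e(s) / 2, e(t) / 2, 0, …, 0)` of the ball. -/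
noncomputable def torusPoint (d : ℕ) (t : UnitAddCircle × UnitAddCircle) : UnitBall (d + 2) :=
  ⟨WithLp.toLp 2 (Fin.cons (fourier 1 t.1 / 2) (Fin.cons (fourier 1 t.2 / 2) 0)), by
    rw [mem_ball_zero_iff, EuclideanSpace.norm_eq, Real.sqrt_lt' one_pos]
    simp only [Fin.sum_univ_succ, Fin.cons_zero, Fin.cons_succ, norm_div, norm_fourier_apply]
    norm_num⟩

theorem inner_torusPoint {d : ℕ} (w : UnitBall (d + 2)) (t) :
    inner ℂ (w : EuclideanSpace ℂ (Fin (d + 2))) (torusPoint d t) =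
      fourier 1 t.1 * ((starRingEnd ℂ) (w.1 0) / 2) +
        fourier 1 t.2 * ((starRingEnd ℂ) (w.1 1) / 2) := by
  simp [PiLp.inner_apply, torusPoint, Fin.sum_univ_succ]
  ring

theorem continuous_torusPoint (d : ℕ) : Continuous (torusPoint d) := by
  refine Continuous.subtype_mk ((PiLp.continuous_toLp 2 _).comp (continuous_pi fun i => ?_)) _
  refine Fin.cases ?_ (fun i => Fin.cases ?_ (fun i => ?_) i) i <;> simp <;> fun_prop

theorem torusPoint_mul (d : ℕ) (t) :
    (torusPoint d t).1 0 * (torusPoint d t).1 1 = torusChar 1 t / 4 := by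
  simp [torusPoint, torusChar]
  ring

/-- AM-GM in the first two coordinates; this is why the factor 2 is admissible inside the lacunary
series. -/
theorem norm_two_mul_mul_le {d : ℕ} {z : EuclideanSpace ℂ (Fin (d + 2))} :
    ‖2 * (z 0 * z 1)‖ ≤ ‖z‖ ^ 2 := by
  rw [EuclideanSpace.norm_sq_eq, Fin.sum_univ_succ, Fin.sum_univ_succ]
  have : 0 ≤ ∑ i : Fin d, ‖z i.succ.succ‖ ^ 2 := by positivity
  simp only [norm_mul, Complex.norm_ofNat, Fin.succ_zero_eq_one]
  nlinarith [sq_nonneg (‖z 0‖ - ‖z 1‖)]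

/-! ### Kernel functions -/

/-- Expanding `‖f y - f x‖ ^ 2` expresses it through inner products alone. -/
theorem continuous_of_continuous_inner {X H : Type*} [TopologicalSpace X] [NormedAddCommGroup H]
    [InnerProductSpace ℂ H] {f : X → H}
    (hf : Continuous fun p : X × X => inner ℂ (f p.1) (f p.2)) : Continuous f := by
  rw [continuous_iff_continuousAt]
  intro x
  rw [ContinuousAt, tendsto_iff_norm_sub_tendsto_zero]
  have h : Continuous fun y => (inner ℂ (f y) (f y)).re - 2 * (inner ℂ (f y) (f x)).re +
      (inner ℂ (f x) (f x)).re := by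
    have h1 : Continuous fun y => inner ℂ (f y) (f y) := hf.comp (continuous_id.prodMk continuous_id)
    have h2 : Continuous fun y => inner ℂ (f y) (f x) :=
      hf.comp (continuous_id.prodMk continuous_const)
    fun_prop
  have h2 := (Real.continuous_sqrt.comp h).tendsto x
  refine (h2.congr fun y => ?_).trans_eq ?_
  · simp only [Function.comp, ← RCLike.re_eq_complex_re, inner_self_eq_norm_sq]
    rw [← norm_sub_sq]
    exact Real.sqrt_sq (norm_nonneg _)
  · simp; ring_nf; simp

/-- The kernel function of the Drury-Arveson space at a point of the ball. -/
noncomputable def kernelFun {d : ℕ} (z : UnitBall d) : DruryArveson d :=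
  RKHS.kerFun (DruryArveson d) z 1

theorem inner_kernelFun {d : ℕ} (z : UnitBall d) (h : DruryArveson d) :
    inner ℂ (kernelFun z) h = h z := by
  simp [kernelFun]

theorem kernelFun_apply {d : ℕ} (z w : UnitBall d) :
    kernelFun w z = (1 - inner ℂ (w : EuclideanSpace ℂ (Fin d)) z)⁻¹ := by
  rw [kernelFun, RKHS.kerFun_apply, RKHS.OfKernel.kernel_ofKernel, druryArvesonKernel_apply]
  simp

theorem one_sub_inner_ne_zero {d : ℕ} (z w : UnitBall d) :
    1 - inner ℂ (w : EuclideanSpace ℂ (Fin d)) (z : EuclideanSpace ℂ (Fin d)) ≠ 0 := by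
  intro h
  have := UnitBall.norm_inner_lt_one z w
  rw [← sub_eq_zero.mp h] at this
  simp at this

theorem continuous_kernelFun (d : ℕ) : Continuous (kernelFun : UnitBall d → DruryArveson d) := by
  refine continuous_of_continuous_inner ?_
  simp only [inner_kernelFun, kernelFun_apply]
  refine Continuous.inv₀ ?_ fun p => one_sub_inner_ne_zero _ _
  fun_prop

theorem DruryArveson.continuous {d : ℕ} (h : DruryArveson d) : Continuous (fun z => h z) := by
  simp only [← inner_kernelFun]
  exact (continuous_kernelFun d).inner continuous_const

theorem kernelFun_zero_apply {d : ℕ} (z : UnitBall d) :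
    kernelFun (⟨0, Metric.mem_ball_self one_pos⟩ : UnitBall d) z = 1 := by
  simp [kernelFun_apply]

/-! ### Diagonal Fourier coefficients of functions in the Drury-Arveson space -/

/-- The element of the Drury-Arveson space that represents the diagonal Fourier coefficient of
frequency `n`. -/
noncomputable def diagVector (d : ℕ) (n : ℤ) : DruryArveson (d + 2) :=
  ∫ t, torusChar n t • kernelFun (torusPoint d t) ∂torusMeasure

theorem inner_diagVector {d : ℕ} (n : ℤ) (h : DruryArveson (d + 2)) :
    inner ℂ (diagVector d n) h = diagCoeff n (fun t => h (torusPoint d t)) := by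
  have hint : Integrable (fun t => torusChar n t • kernelFun (torusPoint d t)) torusMeasure :=
    ((continuous_torusChar n).smul
      ((continuous_kernelFun _).comp (continuous_torusPoint d))).integrable_torus
  rw [← inner_conj_symm, diagVector, ← integral_inner hint, ← integral_conj]
  simp only [inner_conj_symm, inner_smul_left, inner_kernelFun, conj_torusChar, diagCoeff]

theorem hasSum_diagCoeff_kernelFun {d : ℕ} (n : ℤ) (w : UnitBall (d + 2)) :
    HasSum (fun j : ℕ => diagCoeff n (fun t => (fourier 1 t.1 * ((starRingEnd ℂ) (w.1 0) / 2) +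
        fourier 1 t.2 * ((starRingEnd ℂ) (w.1 1) / 2)) ^ j))
      (diagCoeff n (fun t => kernelFun w (torusPoint d t))) := by
  have hw : ‖w.1‖ < 1 := mem_ball_zero_iff.mp w.2
  refine hasSum_diagCoeff n (fun j => by fun_prop)
    (summable_geometric_of_lt_one (norm_nonneg w.1) hw) (fun j t => ?_) (fun t => ?_)
  · rw [← inner_torusPoint, norm_pow]
    refine pow_le_pow_left₀ (norm_nonneg _) ((norm_inner_le_norm _ _).trans ?_) _
    exact mul_le_of_le_one_right (norm_nonneg _) (mem_ball_zero_iff.mp (torusPoint d t).2).le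
  · rw [kernelFun_apply, ← inner_torusPoint]
    exact hasSum_geometric_of_norm_lt_one (UnitBall.norm_inner_lt_one _ _)

/-- In the geometric series of the kernel only the power `j = 2 * n` has frequency `(n, n)`; its
middle binomial coefficient appears. -/
theorem diagVector_apply {d : ℕ} (n : ℕ) (w : UnitBall (d + 2)) :
    diagVector d n w = n.centralBinom * (w.1 0 * w.1 1 / 4) ^ n := by
  have h : diagCoeff n (fun t => kernelFun w (torusPoint d t)) =
      n.centralBinom * ((starRingEnd ℂ) (w.1 0) / 2 * ((starRingEnd ℂ) (w.1 1) / 2)) ^ n := by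
    rw [← diagCoeff_add_pow]
    refine (hasSum_diagCoeff_kernelFun n w).unique (hasSum_single _ fun j hj => ?_)
    exact diagCoeff_add_pow_of_ne (by lia) _ _
  rw [← inner_kernelFun, ← inner_conj_symm, inner_diagVector, h]
  simp only [map_mul, map_pow, map_div₀, Complex.conj_conj, map_natCast, map_ofNat]
  ring

theorem diagVector_apply_of_neg {d : ℕ} {n : ℤ} (hn : n < 0) (w : UnitBall (d + 2)) :
    diagVector d n w = 0 := by
  have h : diagCoeff n (fun t => kernelFun w (torusPoint d t)) = 0 := by
    refine (hasSum_diagCoeff_kernelFun n w).unique (hasSum_zero.congr_fun fun j => ?_)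
    exact diagCoeff_add_pow_of_ne (by lia) _ _
  rw [← inner_kernelFun, ← inner_conj_symm, inner_diagVector, h, map_zero]

theorem diagCoeff_of_neg {d : ℕ} {n : ℤ} (hn : n < 0) (h : DruryArveson (d + 2)) :
    diagCoeff n (fun t => h (torusPoint d t)) = 0 := by
  have : diagVector d n = 0 := RKHS.ext fun w => by simp [diagVector_apply_of_neg hn]
  rw [← inner_diagVector, this, inner_zero_left]

theorem diagCoeff_zero {d : ℕ} (h : DruryArveson (d + 2)) :
    diagCoeff 0 (fun t => h (torusPoint d t)) = h ⟨0, Metric.mem_ball_self one_pos⟩ := by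
  have : diagVector d 0 = kernelFun ⟨0, Metric.mem_ball_self one_pos⟩ := RKHS.ext fun w => by
    rw [kernelFun_zero_apply]
    simpa using diagVector_apply 0 w
  rw [← inner_diagVector, this, inner_kernelFun]

/-- Pairing the vector with itself takes its own diagonal coefficient, and the integrand is constant
on the torus. -/
theorem norm_diagVector_sq (d n : ℕ) : ‖diagVector d n‖ ^ 2 = n.centralBinom / 16 ^ n := by
  have h : inner ℂ (diagVector d n) (diagVector d n) = (n.centralBinom / 16 ^ n : ℂ) := by
    rw [inner_diagVector, diagCoeff]
    have : ∀ t, torusChar (-n) t * diagVector d n (torusPoint d t) =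
        (n.centralBinom / 16 ^ n : ℂ) := by
      intro t
      have h1 : torusChar (-n) t * torusChar n t = 1 := by
        rw [← torusChar_add, neg_add_cancel, torusChar_zero]
      rw [diagVector_apply, torusPoint_mul, div_div, div_pow, torusChar_one_pow]
      norm_num
      linear_combination (n.centralBinom / 16 ^ n : ℂ) * h1
    simp only [this]
    simp
  rw [inner_self_eq_norm_sq_to_K] at h
  exact Complex.ofReal_injective (by push_cast; exact h)

/-- The induction step reduces to `(2k + 1)(2k + 3) ≤ 4 (k + 1) ^ 2`. This bound is the source of
the decay of diagonal coefficients. -/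
theorem centralBinom_sq_mul_le (n : ℕ) : n.centralBinom ^ 2 * (2 * n + 1) ≤ 16 ^ n := by
  induction n with
  | zero => simp
  | succ k ih =>
    have h := Nat.succ_mul_centralBinom_succ k
    refine le_of_mul_le_mul_left (a := (k + 1) ^ 2 * (2 * k + 1)) ?_ (by positivity)
    calc (k + 1) ^ 2 * (2 * k + 1) * ((k + 1).centralBinom ^ 2 * (2 * (k + 1) + 1))
        = ((k + 1) * (k + 1).centralBinom) ^ 2 * ((2 * k + 1) * (2 * (k + 1) + 1)) := by ring
      _ = k.centralBinom ^ 2 * (2 * k + 1) * (4 * (2 * k + 1) ^ 2 * (2 * k + 3)) := by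
        rw [h]; ring
      _ ≤ 16 ^ k * (4 * (2 * k + 1) ^ 2 * (2 * k + 3)) := by gcongr
      _ = 16 ^ k * (2 * k + 1) * (4 * ((2 * k + 1) * (2 * k + 3))) := by ring
      _ ≤ 16 ^ k * (2 * k + 1) * (16 * (k + 1) ^ 2) := by
        gcongr _ * ?_
        nlinarith
      _ = _ := by ring

/-- Cauchy-Schwarz against `diagVector`. The parameter `q` stands in for the fourth root of `2n +
1`. -/
theorem norm_diagCoeff_le {d : ℕ} (n : ℕ) (h : DruryArveson (d + 2)) {q : ℝ} (hq : 0 < q)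
    (hn : q ^ 4 ≤ 2 * n + 1) : 2 ^ n * ‖diagCoeff n (fun t => h (torusPoint d t))‖ ≤ ‖h‖ / q := by
  have h1 : (2 ^ n * ‖diagVector d n‖ * q) ^ 4 ≤ 1 ^ 4 := by
    have h2 : (n.centralBinom : ℝ) ^ 2 * (2 * n + 1) ≤ 16 ^ n := by
      exact_mod_cast centralBinom_sq_mul_le n
    calc (2 ^ n * ‖diagVector d n‖ * q) ^ 4 = 16 ^ n * (‖diagVector d n‖ ^ 2) ^ 2 * q ^ 4 := by
          rw [mul_pow, mul_pow, ← pow_mul, mul_comm n, pow_mul]; ring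
      _ ≤ 16 ^ n * (‖diagVector d n‖ ^ 2) ^ 2 * (2 * n + 1) := by gcongr
      _ = (n.centralBinom : ℝ) ^ 2 * (2 * n + 1) / 16 ^ n := by
          rw [norm_diagVector_sq]; field_simp
      _ ≤ 1 ^ 4 := by rw [one_pow]; exact div_le_one_of_le₀ h2 (by positivity)
  have h3 := le_of_pow_le_pow_left₀ (by norm_num) zero_le_one h1
  rw [← inner_diagVector, le_div_iff₀ hq]
  calc 2 ^ n * ‖inner ℂ (diagVector d n) h‖ * q ≤ 2 ^ n * (‖diagVector d n‖ * ‖h‖) * q := by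
        gcongr; exact norm_inner_le_norm _ _
    _ = (2 ^ n * ‖diagVector d n‖ * q) * ‖h‖ := by ring
    _ ≤ ‖h‖ := mul_le_of_le_one_left (norm_nonneg _) h3

/-! ### The lacunary function -/

/-- A lacunary power series that converges absolutely on the closed unit disc. -/
noncomputable def lacunarySeries (w : ℂ) : ℂ :=
  ∑' k : ℕ, (1 / 2 / 2 ^ k : ℂ) * w ^ 256 ^ k

theorem norm_lacunarySeries_term_le {w : ℂ} (hw : ‖w‖ ≤ 1) (k : ℕ) :
    ‖(1 / 2 / 2 ^ k : ℂ) * w ^ 256 ^ k‖ ≤ 1 / 2 / 2 ^ k := by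
  rw [norm_mul, norm_pow]
  have : ‖(1 / 2 / 2 ^ k : ℂ)‖ = 1 / 2 / 2 ^ k := by simp
  rw [this]
  exact mul_le_of_le_one_right (by positivity) (pow_le_one₀ (norm_nonneg _) hw)

theorem hasSum_lacunarySeries {w : ℂ} (hw : ‖w‖ ≤ 1) :
    HasSum (fun k : ℕ => (1 / 2 / 2 ^ k : ℂ) * w ^ 256 ^ k) (lacunarySeries w) :=
  (Summable.of_norm_bounded (summable_geometric_two' 1)
    (norm_lacunarySeries_term_le hw)).hasSum

theorem continuousOn_lacunarySeries : ContinuousOn lacunarySeries (Metric.closedBall 0 1) :=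
  continuousOn_tsum (fun k => by fun_prop) (summable_geometric_two' 1) fun k w hw =>
    norm_lacunarySeries_term_le (mem_closedBall_zero_iff.mp hw) k

theorem differentiableOn_lacunarySeries : DifferentiableOn ℂ lacunarySeries (Metric.ball 0 1) :=
  Complex.differentiableOn_tsum_of_summable_norm (summable_geometric_two' 1) (fun k => by fun_prop)
    Metric.isOpen_ball fun k w hw => norm_lacunarySeries_term_le (mem_ball_zero_iff.mp hw).le k

theorem lacunarySeries_mem_ballAlgebra (d : ℕ) :
    (fun z : EuclideanSpace ℂ (Fin (d + 2)) => lacunarySeries (2 * (z 0 * z 1))) ∈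
      ballAlgebra (d + 2) := by
  constructor
  · refine continuousOn_lacunarySeries.comp (by fun_prop) fun z hz => ?_
    rw [mem_closedBall_zero_iff] at hz ⊢
    exact norm_two_mul_mul_le.trans (pow_le_one₀ (norm_nonneg _) hz)
  · refine differentiableOn_lacunarySeries.comp (by fun_prop) fun z hz => ?_
    rw [mem_ball_zero_iff] at hz ⊢
    exact norm_two_mul_mul_le.trans_lt (pow_lt_one₀ (norm_nonneg _) hz two_ne_zero)

/-! ### Comparison of diagonal coefficients -/

theorem hasSum_diagCoeff_lacunarySeries_mul {d : ℕ} (n : ℤ) (m : DruryArveson (d + 2)) :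
    HasSum (fun k : ℕ => (1 / 2 / 2 ^ k / 2 ^ 256 ^ k : ℂ) *
        diagCoeff (n - 256 ^ k) (fun t => m (torusPoint d t)))
      (diagCoeff n (fun t => lacunarySeries (torusChar 1 t / 2) * m (torusPoint d t))) := by
  have hm : Continuous fun t => m (torusPoint d t) :=
    (DruryArveson.continuous m).comp (continuous_torusPoint d)
  obtain ⟨C, hC⟩ := (isCompact_range hm).isBounded.exists_norm_le
  have hw : ∀ t, ‖torusChar 1 t / 2‖ ≤ 1 := fun t => by
    rw [norm_div, norm_torusChar]; norm_num
  have hc := continuous_torusChar 1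
  refine (hasSum_diagCoeff n
    (φ := fun k t => (1 / 2 / 2 ^ k : ℂ) * (torusChar 1 t / 2) ^ 256 ^ k * m (torusPoint d t))
    (fun k => (continuous_const.mul ((hc.div_const 2).pow _)).mul hm)
    ((summable_geometric_two' 1).mul_right C) (fun k t => ?_)
    (fun t => (hasSum_lacunarySeries (hw t)).mul_right _)).congr_fun fun k => ?_
  · rw [norm_mul]
    gcongr
    exacts [norm_lacunarySeries_term_le (hw t) k, hC _ ⟨t, rfl⟩]
  · have := diagCoeff_torusChar_mul n (256 ^ k : ℕ) (fun t => m (torusPoint d t))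
    rw [Nat.cast_pow, Nat.cast_ofNat] at this
    rw [← this, diagCoeff, diagCoeff, ← integral_const_mul]
    congr! 2 with t
    rw [div_pow, torusChar_one_pow, Nat.cast_pow, Nat.cast_ofNat]
    ring

/-- A quantitative form of the statement that the lacunary function does not multiply an element of
the Drury-Arveson space that is nonzero at the origin into the Drury-Arveson space. -/
theorem norm_apply_zero_le_of_eq_mul {d : ℕ} {g m : DruryArveson (d + 2)}
    (h : ∀ z : UnitBall (d + 2), g z = lacunarySeries (2 * (z.1 0 * z.1 1)) * m z) (K : ℕ) :
    ‖m ⟨0, Metric.mem_ball_self one_pos⟩‖ ≤ 2 * (‖g‖ + ‖m‖) / 2 ^ K := by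
  set N : ℕ := 256 ^ K with hN
  -- The reason for the ratio 256: its fourth root 4 beats the ratio 2 of the lacunary weights.
  have hNK : (4 ^ K : ℝ) ^ 4 = N := by
    rw [hN, ← pow_mul, mul_comm, pow_mul]; norm_num
  have hgm : diagCoeff N (fun t => g (torusPoint d t)) =
      ∑ k ∈ Finset.range (K + 1), (1 / 2 / 2 ^ k / 2 ^ 256 ^ k : ℂ) *
        diagCoeff (N - 256 ^ k) (fun t => m (torusPoint d t)) := by
    have h1 : ∀ t, 2 * ((torusPoint d t).1 0 * (torusPoint d t).1 1) = torusChar 1 t / 2 :=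
      fun t => by rw [torusPoint_mul]; ring
    simp only [h, h1]
    refine (hasSum_diagCoeff_lacunarySeries_mul N m).unique
      (hasSum_sum_of_ne_finset_zero fun k hk => ?_)
    rw [Finset.mem_range, not_lt] at hk
    -- For `k > K` the shifted frequency is negative.
    rw [diagCoeff_of_neg, mul_zero]
    rw [hN, Nat.cast_pow, sub_neg]
    exact pow_lt_pow_right₀ (by norm_num) hk
  -- The term `k = K` has frequency 0 and so contributes `m(0)`.
  rw [Finset.sum_range_succ, hN, Nat.cast_pow, Nat.cast_ofNat, sub_self, diagCoeff_zero,
    ← sub_eq_iff_eq_add'] at hgm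
  have hg : 2 ^ N * ‖diagCoeff N (fun t => g (torusPoint d t))‖ ≤ ‖g‖ / 4 ^ K :=
    norm_diagCoeff_le N g (by positivity) (by rw [hNK]; linarith [N.cast_nonneg (α := ℝ)])
  have hm : ∀ k ∈ Finset.range K, 2 ^ N * ‖(1 / 2 / 2 ^ k / 2 ^ 256 ^ k : ℂ) *
      diagCoeff ((256 : ℤ) ^ K - 256 ^ k) (fun t => m (torusPoint d t))‖ ≤
      1 / 2 / 2 ^ k * (‖m‖ / 4 ^ K) := by
    intro k hk
    -- Hence the frequency `N - 256 ^ k` is at least `N / 2`, and the decay bound with `q = 4 ^ K`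
    -- still applies.
    have hle : 2 * 256 ^ k ≤ N := by
      calc 2 * 256 ^ k ≤ 256 ^ (k + 1) := by rw [pow_succ]; lia
        _ ≤ N := Nat.pow_le_pow_right (by norm_num) (Finset.mem_range.mp hk)
    have hcast : ((256 : ℤ) ^ K - 256 ^ k) = ((N - 256 ^ k : ℕ) : ℤ) := by
      rw [Nat.cast_sub (by lia)]; simp [hN]
    have hq : (4 ^ K : ℝ) ^ 4 ≤ 2 * (N - 256 ^ k : ℕ) + 1 := by
      rw [hNK]
      exact_mod_cast (by lia : N ≤ 2 * (N - 256 ^ k) + 1)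
    have := norm_diagCoeff_le (N - 256 ^ k) m (by positivity) hq
    have hpow : (2 : ℝ) ^ N = 2 ^ (N - 256 ^ k) * 2 ^ 256 ^ k := by
      rw [← pow_add]; congr 1; lia
    have hn : ‖(1 / 2 / 2 ^ k / 2 ^ 256 ^ k : ℂ)‖ = 1 / 2 / 2 ^ k / 2 ^ 256 ^ k := by simp
    rw [norm_mul, hn, hcast, hpow]
    refine le_trans (le_of_eq ?_) (mul_le_mul_of_nonneg_left this (by positivity))
    field_simp
  have hsum : ∑ k ∈ Finset.range K, (1 / 2 / 2 ^ k : ℝ) ≤ 1 :=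
    ((summable_geometric_two' 1).sum_le_tsum _ fun k _ => by positivity).trans_eq
      (tsum_geometric_two' 1)
  have h2 := congrArg (fun x => 2 ^ N * ‖x‖) hgm
  have hn : ‖(1 / 2 / 2 ^ K / 2 ^ 256 ^ K : ℂ)‖ = 1 / 2 / 2 ^ K / 2 ^ N := by simp [hN]
  beta_reduce at h2
  rw [norm_mul, hn, mul_comm _ ‖m _‖] at h2
  have h3 : ‖m ⟨0, Metric.mem_ball_self one_pos⟩‖ * (1 / 2 / 2 ^ K) ≤ (‖g‖ + ‖m‖) / 4 ^ K := by
    calc _ = 2 ^ N * (‖m ⟨0, Metric.mem_ball_self one_pos⟩‖ * (1 / 2 / 2 ^ K / 2 ^ N)) := by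
          field_simp
      _ ≤ 2 ^ N * (‖diagCoeff N (fun t => g (torusPoint d t))‖ +
          ∑ k ∈ Finset.range K, ‖(1 / 2 / 2 ^ k / 2 ^ 256 ^ k : ℂ) *
            diagCoeff ((256 : ℤ) ^ K - 256 ^ k) (fun t => m (torusPoint d t))‖) := by
          rw [← h2]
          gcongr
          refine (norm_sub_le _ _).trans (add_le_add (le_of_eq ?_) (norm_sum_le _ _))
          simp [hN]
      _ ≤ ‖g‖ / 4 ^ K + ∑ k ∈ Finset.range K, 1 / 2 / 2 ^ k * (‖m‖ / 4 ^ K) := by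
          rw [mul_add, Finset.mul_sum]
          exact add_le_add hg (Finset.sum_le_sum hm)
      _ ≤ ‖g‖ / 4 ^ K + 1 * (‖m‖ / 4 ^ K) := by
          rw [← Finset.sum_mul]; gcongr
      _ = _ := by ring
  have h4 : (4 : ℝ) ^ K = 2 ^ K * 2 ^ K := by rw [← mul_pow]; norm_num
  rw [h4] at h3
  rw [le_div_iff₀ (by positivity)] at h3 ⊢
  refine le_trans (le_of_eq ?_) (mul_le_mul_of_nonneg_left h3 two_pos.le)
  field_simp

theorem lacunarySeries_notMem_nevanlinnaClass (d : ℕ) :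
    (fun z : UnitBall (d + 2) => lacunarySeries (2 * (z.1 0 * z.1 1))) ∉
      nevanlinnaClass (d + 2) := by
  rintro ⟨g, μ, hμ, hμ0, hf⟩
  -- The kernel function at the origin is the constant 1, so `μ` itself is represented by an element
  -- of the space.
  obtain ⟨m, hm⟩ := hμ (kernelFun ⟨0, Metric.mem_ball_self one_pos⟩)
  simp only [kernelFun_zero_apply, mul_one] at hm
  have h : ∀ z : UnitBall (d + 2), g z = lacunarySeries (2 * (z.1 0 * z.1 1)) * m z := fun z => by
    rw [hm]
    exact (div_eq_iff (hμ0 z)).mp (hf z).symm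
  have hlim : Filter.Tendsto (fun K : ℕ => 2 * (‖g‖ + ‖m‖) / 2 ^ K) Filter.atTop (nhds 0) :=
    tendsto_const_nhds.div_atTop (tendsto_pow_atTop_atTop_of_one_lt one_lt_two)
  have h0 := ge_of_tendsto' hlim (norm_apply_zero_le_of_eq_mul h)
  rw [norm_le_zero_iff, hm] at h0
  exact hμ0 _ h0

theorem theorem1p9 (d : ℕ) (hd : 2 ≤ d) :
    ∃ f ∈ ballAlgebra d, (fun z : UnitBall d => f z) ∉ nevanlinnaClass d := by
  obtain ⟨e, rfl⟩ := Nat.exists_eq_add_of_le' hd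
  exact ⟨_, lacunarySeries_mem_ballAlgebra e, lacunarySeries_notMem_nevanlinnaClass e⟩
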